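/- **Model.** Let $n\ge 1$, let $\mathcal V$ be a set of $n$ users and $\mathcal I$ a finite set of influencers. Let $P\in\mathbb R^{n\times n}$ be row stochastic; its graph has an edge $v\to w$ whenever $P_{vw}>0$. A node is aperiodic if the greatest common divisor of the lengths of the closed walks through it is $1$. Let $\alpha_v,\beta_v,\gamma_v\ge 0$ with $\alpha_v+\beta_v+\gamma_v=1$, let $q^{(i)}$ be the quality of influencer $i$, and let the attention $x^{(i)}_v(t)$ of user $v$ towards influencer $i$ evolve from $x^{(i)}_v(0)\in[0,1]$ by $$x_v^{(i)}(t+1)=\alpha_v\sum_{w}P_{vw}x_w^{(i)}(t)+\beta_v\pi^{(i)}(t)+\gamma_v q^{(i)},\qquad \pi^{(i)}(t)=\frac{\sum_v x_v^{(i)}(t)}{\sum_j\sum_w x_w^{(j)}(t)} .$$ Put $A=\mathrm{diag}(\alpha)$, $z(t)=\sum_i x^{(i)}(t)$, $s^{(i)}(t)=(x^{(i)}(t)^\top,\pi^{(i)}(t))^\top\in\mathbb R^{n+1}$, $\lambda_1=\rho(AP)$ (spectral radius), and, for $\zeta\in\mathbb R^n$, $$U[\zeta]=\begin{bmatrix}AP&(I-A)\mathbf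 1\\ \frac{\mathbf 1^\top AP}{\mathbf 1^\top \zeta}&\frac{\mathbf 1^\top(I-A)\mathbf 1}{\mathbf 1^\top \zeta}\end{bmatrix},\qquad \widetilde U=U[\mathbf 1].$$ **Theorem (Convergence -- No quality).** Let $\gamma_v=0$ for all $v$, let $z(0)\ge\mathbf 1$ entrywise, and assume that from every $v\in\mathcal V$ there is a path to an aperiodic node $w$ with $\alpha_w<1$. Then $\lambda_1<1$, $\widetilde U$ has a unique stationary distribution $\tilde\phi$, and there is a vector $\phi\in\mathbb R^{n+1}$, which depends only on $P$, $\alpha$ and $z(0)$ (so it is the same for all influencers), such that for every $i\in\mathcal I$ the vectors $s^{(i)}(t)$ satisfy $s^{(i)}(t+1)=U[z(t+1)]\,s^{(i)}(t)$ and $$\lim_{t\to\infty}s^{(i)}(t)=\phi^\top s^{(i)}(0)\,\mathbf 1_{n+1};$$ more generally, every solution of $y(t+1)=U[z(t+1)]\,y(t)$ in $\mathbb R^{n+1}$ converges to $\phi^\top y(0)\,\mathbf 1_{n+1}$. Moreover, if $\lambda_1>0$ or $\alpha=0$, then $$\|\phi-\tilde\phi\|_1\le\chi\,\|z(0)-\mathbf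 1\|_1\,\frac{\lambda_1\,\mathfrak p_n(\lambda_1)}{(1-\lambda_1)^{n+1}},$$ where $\mathfrak p_n$ is a polynomial of degree $n$ with $\mathfrak p_n(0)=1$ that depends only on $n$, and $\chi>0$ is a constant that depends only on $P$ and $\alpha$ and does not change when $\alpha$ is multiplied by a positive scalar. -/

import Mathlib

open Filter Topology Matrix

/-- Normalized popularity of influencer `i` when the attention of user `v` towards influencer `j`
is `x j v`: its share of the total attention. -/
noncomputable def popularity {n : ℕ} {ι : Type*} [Fintype ι] (x : ι → Fin n → ℝ) (i : ι) : ℝ :=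
  (∑ v, x i v) / ∑ j, ∑ w, x j w

/-- The attention dynamics: `attention P α β γ q x₀ t i v` is the attention at time `t` of user `v`
towards influencer `i`, where `P` is the weight matrix of the social network, `α`, `β`, `γ` are the
weights of network, popularity and quality, `q` is the quality and `x₀` the initial attention. -/
noncomputable def attention {n : ℕ} {ι : Type*} [Fintype ι] (P : Matrix (Fin n) (Fin n) ℝ)
    (α β γ : Fin n → ℝ) (q : ι → ℝ) (x₀ : ι → Fin n → ℝ) : ℕ → ι → Fin n → ℝ
  | 0 => x₀
  | t + 1 => fun i v =>
      α v * ∑ w, P v w * attention P α β γ q x₀ t i w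
        + β v * popularity (attention P α β γ q x₀ t) i + γ v * q i

/-- The total attention of each user, `z = ∑ i, x i`. -/
def totalAttention {n : ℕ} {ι : Type*} [Fintype ι] (x : ι → Fin n → ℝ) : Fin n → ℝ :=
  fun v => ∑ i, x i v

/-- The vector of length `n + 1` which collects the attentions towards influencer `i` and its
popularity; the last entry is indexed by the element of `Unit`. -/
noncomputable def jointState {n : ℕ} {ι : Type*} [Fintype ι] (x : ι → Fin n → ℝ) (i : ι) :
    Fin n ⊕ Unit → ℝ :=
  Sum.elim (x i) (fun _ => popularity x i)

/-- The matrix `A P`, where `A` is the diagonal matrix with diagonal `α`. -/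
def networkMatrix {n : ℕ} (P : Matrix (Fin n) (Fin n) ℝ) (α : Fin n → ℝ) :
    Matrix (Fin n) (Fin n) ℝ :=
  Matrix.diagonal α * P

/-- The block matrix with rows `[A P, B 1]` and `[1ᵀ A P / 1ᵀ ζ, 1ᵀ B 1 / 1ᵀ ζ]`, where `A` and `B`
are the diagonal matrices with diagonals `α` and `β`. -/
noncomputable def jointMatrix {n : ℕ} (P : Matrix (Fin n) (Fin n) ℝ) (α β ζ : Fin n → ℝ) :
    Matrix (Fin n ⊕ Unit) (Fin n ⊕ Unit) ℝ :=
  Matrix.fromBlocks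
    (networkMatrix P α)
    (Matrix.of fun v _ => β v)
    (Matrix.of fun _ w => (∑ v, networkMatrix P α v w) / ∑ v, ζ v)
    (Matrix.of fun _ _ => (∑ v, β v) / ∑ v, ζ v)

/-- There is a directed walk with `k` edges from `v` to `w` in the graph associated to `P`,
whose edges are the pairs `(a, b)` with `P a b > 0`. -/
def IsWalkLength {n : ℕ} (P : Matrix (Fin n) (Fin n) ℝ) (v w : Fin n) (k : ℕ) : Prop :=
  ∃ c : ℕ → Fin n, c 0 = v ∧ c k = w ∧ ∀ j < k, 0 < P (c j) (c (j + 1))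

/-- The node `v` is aperiodic: the greatest common divisor of the lengths of the closed walks
through `v` is `1`. -/
def IsAperiodicNode {n : ℕ} (P : Matrix (Fin n) (Fin n) ℝ) (v : Fin n) : Prop :=
  ∀ d : ℕ, (∀ k, IsWalkLength P v v k → d ∣ k) → d = 1

/-- The spectral radius of a real matrix: the largest modulus of a complex eigenvalue. -/
noncomputable def spectralRad {n : ℕ} (M : Matrix (Fin n) (Fin n) ℝ) : ℝ :=
  (spectralRadius ℂ (M.map Complex.ofReal)).toReal

/-- `ψ` is a probability vector with `ψᵀ M = ψᵀ`. -/
def IsStationaryDistribution {m : Type*} [Fintype m] (M : Matrix m m ℝ) (ψ : m → ℝ) : Prop :=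
  ψ ∈ stdSimplex ℝ m ∧ ψ ᵥ* M = ψ

/-!
Write `N = A P`. Without quality the total attention satisfies `z(t) = 1 + N ^ t (z(0) - 1)`
(`totalAttention_attention`), so it does not depend on the way the attention is split among the
influencers, and all its entries stay at least `1`.

The walks to nodes with `α < 1` give two facts. Some power of `N` has row sums bounded away from `1`;
hence `ρ(N) < 1` and `∑ N ^ t` converges. And the popularity node can be reached from every node; as
it also carries a loop, some power of the limiting joint matrix `U[1]` has a positive column, so that
Doeblin's contraction makes all rows of `U[1] ^ t` converge to the unique stationary distribution `ψ`
(`exists_tendsto_pow_apply`).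

The matrices `U[z(t + 1)]` and `U[1]` differ in the last row only. A solution `y` of the joint
dynamics therefore satisfies `y(t + 1) = U[1] y(t) - ε(t) y_*(t + 1) e_*`, where `*` is the popularity
node and `ε(t) = 1ᵀ N ^ (t + 1) (z(0) - 1) / n` is summable. By dominated convergence such a perturbed
chain reaches consensus at `ψᵀ y(0) - ψ_* ∑ ε(t) y_*(t + 1)` (`tendsto_of_perturbed`). The matrices
`U[z(t + 1)]` are substochastic, so `|y_*|` never exceeds the sup norm of `y(0)`, and testing with
sign vectors `y(0)` yields `‖φ - ψ‖₁ ≤ ∑ ε(t)`.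

This sum equals `1ᵀ N (1 - N)⁻¹ (z(0) - 1) / n`. Cramer's rule bounds the entries of the inverse by
`n! / |det (1 - N)|`, where `|det (1 - N)| = ∏ |1 - μ| ≥ (1 - ρ(N)) ^ n` over the eigenvalues `μ`, and
the remaining factor `N` contributes `‖α‖`, which for `ρ(N) > 0` is a scale-invariant multiple of `ρ(N)`.
-/

/-! ### Contraction over blocks of time -/

theorem summable_of_shift_le {a : ℕ → ℝ} (ha : ∀ t, 0 ≤ a t) {K : ℕ} {θ : ℝ} (hθ : θ < 1)
    (h : ∀ t, a (t + K) ≤ θ * a t) : Summable a := by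
  -- a partial sum `S` satisfies `S ≤ (sum of the first K terms) + θ * S`
  refine summable_of_sum_range_le (c := (∑ t ∈ Finset.range K, a t) / (1 - θ)) ha fun T => ?_
  rw [le_div_iff₀ (by linarith)]
  have h1 : ∑ t ∈ Finset.range T, a t ≤ ∑ t ∈ Finset.range (K + T), a t :=
    Finset.sum_le_sum_of_subset_of_nonneg (Finset.range_mono (by omega)) fun i _ _ => ha i
  rw [Finset.sum_range_add] at h1
  have h2 : ∑ t ∈ Finset.range T, a (K + t) ≤ θ * ∑ t ∈ Finset.range T, a t := by
    rw [Finset.mul_sum]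
    exact Finset.sum_le_sum fun t _ => by rw [add_comm]; exact h t
  linarith

theorem abs_mulVec_le {m : Type*} [Fintype m] {M : Matrix m m ℝ} (hM : ∀ i j, 0 ≤ M i j)
    (h1 : ∀ i, ∑ j, M i j ≤ 1)
    {u : m → ℝ} {C : ℝ} (hu : ∀ j, |u j| ≤ C) (i : m) : |(M *ᵥ u) i| ≤ C := by
  have hC : 0 ≤ C := (abs_nonneg _).trans (hu i)
  calc |(M *ᵥ u) i| ≤ ∑ j, |M i j * u j| := Finset.abs_sum_le_sum_abs _ _
    _ ≤ ∑ j, M i j * C := Finset.sum_le_sum fun j _ => by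
        rw [abs_mul, abs_of_nonneg (hM i j)]
        exact mul_le_mul_of_nonneg_left (hu j) (hM i j)
    _ ≤ C := by
        rw [← Finset.sum_mul]
        exact mul_le_of_le_one_left hC (h1 i)

/-! ### Stochastic matrices with a positive column in some power -/

section Stochastic

variable {m : Type*} [Fintype m] [DecidableEq m] {M : Matrix m m ℝ}

theorem sum_vecMul_of_mem_rowStochastic (hM : M ∈ rowStochastic ℝ m) (h : m → ℝ) :
    ∑ j, (h ᵥ* M) j = ∑ j, h j := by
  simp only [vecMul, dotProduct]
  rw [Finset.sum_comm]
  simp [← Finset.mul_sum, sum_row_of_mem_rowStochastic hM]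

/-- Doeblin's contraction estimate: a stochastic matrix which has a column with all entries at
least `δ` contracts zero-sum row vectors in the `ℓ¹` norm by the factor `1 - δ`. -/
theorem sum_abs_vecMul_le (hM : M ∈ rowStochastic ℝ m) {k : m} {δ : ℝ}
    (hδ : ∀ i, δ ≤ M i k) {h : m → ℝ} (hh : ∑ j, h j = 0) :
    ∑ j, |(h ᵥ* M) j| ≤ (1 - δ) * ∑ j, |h j| := by
  have key : ∀ j, (h ᵥ* M) j = ∑ i, h i * (M i j - if j = k then δ else 0) := by
    intro j
    simp only [vecMul, dotProduct, mul_sub, Finset.sum_sub_distrib, ← Finset.sum_mul, hh]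
    ring
  have hnn : ∀ i j, 0 ≤ M i j - if j = k then δ else 0 := by
    intro i j
    split_ifs with hj
    · subst hj; linarith [hδ i]
    · simpa using nonneg_of_mem_rowStochastic hM
  calc ∑ j, |(h ᵥ* M) j|
      ≤ ∑ j, ∑ i, |h i| * (M i j - if j = k then δ else 0) := by
        refine Finset.sum_le_sum fun j _ => ?_
        rw [key]
        refine (Finset.abs_sum_le_sum_abs _ _).trans (Finset.sum_le_sum fun i _ => ?_)
        rw [abs_mul, abs_of_nonneg (hnn i j)]
    _ = (1 - δ) * ∑ j, |h j| := by
        rw [Finset.sum_comm]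
        simp only [← Finset.mul_sum, Finset.sum_sub_distrib, sum_row_of_mem_rowStochastic hM,
          Finset.sum_ite_eq', Finset.mem_univ, if_true]
        rw [← Finset.sum_mul, mul_comm]

theorem summable_abs_vecMul_pow (hM : M ∈ rowStochastic ℝ m) {k : m} {K : ℕ} {δ : ℝ}
    (hδ0 : 0 < δ) (hδ : ∀ i, δ ≤ (M ^ K) i k) {h : m → ℝ} (hh : ∑ j, h j = 0) :
    Summable fun t => ∑ j, |(h ᵥ* M ^ t) j| := by
  refine summable_of_shift_le (K := K) (θ := 1 - δ)
    (fun t => Finset.sum_nonneg fun j _ => abs_nonneg _) (by linarith) fun t => ?_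
  have := sum_abs_vecMul_le (pow_mem hM K) hδ (h := h ᵥ* M ^ t)
    (by rw [sum_vecMul_of_mem_rowStochastic (pow_mem hM t), hh])
  simpa only [vecMul_vecMul, ← pow_add] using this

/-- If some power of a stochastic matrix has a positive column, all rows of its powers converge to
one and the same vector. -/
theorem exists_tendsto_pow_apply (hM : M ∈ rowStochastic ℝ m) {k : m} {K : ℕ} {δ : ℝ}
    (hδ0 : 0 < δ) (hδ : ∀ i, δ ≤ (M ^ K) i k) :
    ∃ ψ : m → ℝ, ∀ i j, Tendsto (fun t => (M ^ t) i j) atTop (𝓝 (ψ j)) := by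
  have hz : ∀ {h : m → ℝ}, ∑ j, h j = 0 → ∀ j, Summable fun t => |(h ᵥ* M ^ t) j| := by
    intro h hh j
    refine Summable.of_nonneg_of_le (fun t => abs_nonneg _) (fun t => ?_)
      (summable_abs_vecMul_pow hM hδ0 hδ hh)
    exact Finset.single_le_sum (f := fun j => |(h ᵥ* M ^ t) j|)
      (fun j _ => abs_nonneg _) (Finset.mem_univ j)
  have hrow : ∀ i j t, (M ^ t) i j = (Pi.single i 1 ᵥ* M ^ t) j := by simp
  -- the increments of row `k` come from the zero-sum vector `e_k M - e_k`
  have hconv : ∀ j, ∃ c, Tendsto (fun t => (M ^ t) k j) atTop (𝓝 c) := by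
    intro j
    refine cauchySeq_tendsto_of_complete (cauchySeq_of_summable_dist ?_)
    have := hz (h := Pi.single k 1 - Pi.single k 1 ᵥ* M) (by
      simp [Finset.sum_sub_distrib, sum_row_of_mem_rowStochastic hM]) j
    refine this.congr fun t => ?_
    rw [Real.dist_eq, hrow, hrow, sub_vecMul, vecMul_vecMul, ← pow_succ', Pi.sub_apply]
  choose ψ hψ using hconv
  refine ⟨ψ, fun i j => ?_⟩
  have h0 := (hz (h := Pi.single i 1 - Pi.single k 1) (by simp) j).tendsto_atTop_zero
  rw [← Function.comp_def abs, ← tendsto_zero_iff_abs_tendsto_zero] at h0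
  have := h0.add (hψ j)
  rw [zero_add] at this
  refine this.congr fun t => ?_
  rw [sub_vecMul, Pi.sub_apply, ← hrow, ← hrow]
  ring

theorem isStationaryDistribution_of_tendsto [Nonempty m] (hM : M ∈ rowStochastic ℝ m) {ψ : m → ℝ}
    (hψ : ∀ i j, Tendsto (fun t => (M ^ t) i j) atTop (𝓝 (ψ j))) :
    IsStationaryDistribution M ψ := by
  obtain ⟨i⟩ := ‹Nonempty m›
  refine ⟨⟨fun j => ge_of_tendsto' (hψ i j) fun t =>
    nonneg_of_mem_rowStochastic (pow_mem hM t), ?_⟩, ?_⟩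
  · refine tendsto_nhds_unique (tendsto_finsetSum _ fun j _ => hψ i j) ?_
    simp only [sum_row_of_mem_rowStochastic (pow_mem hM _)]
    exact tendsto_const_nhds
  · ext j
    refine tendsto_nhds_unique ?_ ((hψ i j).comp (tendsto_add_atTop_nat 1))
    have : Tendsto (fun t => ∑ l, (M ^ t) i l * M l j) atTop (𝓝 (∑ l, ψ l * M l j)) :=
      tendsto_finsetSum _ fun l _ => (hψ i l).mul_const _
    refine this.congr fun t => ?_
    simp [pow_succ, Matrix.mul_apply]

theorem IsStationaryDistribution.eq_of_tendsto {ψ ψ' : m → ℝ}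
    (hψ : ∀ i j, Tendsto (fun t => (M ^ t) i j) atTop (𝓝 (ψ j)))
    (h : IsStationaryDistribution M ψ') : ψ' = ψ := by
  have hpow : ∀ t, ψ' ᵥ* M ^ t = ψ' := by
    intro t
    induction t with
    | zero => simp
    | succ t ih => rw [pow_succ, ← vecMul_vecMul, ih, h.2]
  ext j
  have h1 : Tendsto (fun t => ∑ l, ψ' l * (M ^ t) l j) atTop (𝓝 (∑ l, ψ' l * ψ j)) :=
    tendsto_finsetSum _ fun l _ => (hψ l j).const_mul _
  rw [← Finset.sum_mul, h.1.2, one_mul] at h1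
  refine tendsto_nhds_unique (tendsto_const_nhds.congr fun t => ?_) h1
  exact (congrFun (hpow t) j).symm

theorem eq_pow_mulVec_add_sum {y e : ℕ → m → ℝ} (h : ∀ t, y (t + 1) = M *ᵥ y t + e t) (t : ℕ) :
    y t = M ^ t *ᵥ y 0 + ∑ s ∈ Finset.range t, M ^ (t - 1 - s) *ᵥ e s := by
  induction t with
  | zero => simp
  | succ t ih =>
    rw [h, ih, mulVec_add, mulVec_mulVec, ← pow_succ', Finset.sum_range_succ, add_assoc]
    simp only [add_tsub_cancel_right, tsub_self, pow_zero, one_mulVec, mulVec_sum, mulVec_mulVec,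
      ← pow_succ']
    congr 2
    refine Finset.sum_congr rfl fun s hs => ?_
    rw [Finset.mem_range] at hs
    rw [show t - 1 - s + 1 = t - s by omega]

/-- A summable perturbation of a convergent Markov chain still reaches consensus, and the limit is
the stationary mean of the initial value plus the stationary means of all perturbations. -/
theorem tendsto_of_perturbed (hM : M ∈ rowStochastic ℝ m) {ψ : m → ℝ}
    (hψ : ∀ i j, Tendsto (fun t => (M ^ t) i j) atTop (𝓝 (ψ j))) {y e : ℕ → m → ℝ}
    (h : ∀ t, y (t + 1) = M *ᵥ y t + e t) {b : ℕ → ℝ} (hb : Summable b)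
    (he : ∀ t j, |e t j| ≤ b t) (i : m) :
    Tendsto (fun t => y t i) atTop (𝓝 (ψ ⬝ᵥ y 0 + ∑' s, ψ ⬝ᵥ e s)) := by
  have hlim : ∀ u : m → ℝ, Tendsto (fun t => (M ^ t *ᵥ u) i) atTop (𝓝 (ψ ⬝ᵥ u)) := fun u =>
    tendsto_finsetSum _ fun j _ => (hψ i j).mul_const _
  have hsum : Tendsto
      (fun t => ∑' s, if s < t then (M ^ (t - 1 - s) *ᵥ e s) i else 0) atTop
      (𝓝 (∑' s, ψ ⬝ᵥ e s)) := by
    refine tendsto_tsum_of_dominated_convergence hb (fun s => ?_) (Eventually.of_forall ?_)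
    · have hs : Tendsto (fun t : ℕ => t - 1 - s) atTop atTop := by
        simpa only [Nat.sub_sub] using tendsto_sub_atTop_nat (1 + s)
      refine ((hlim (e s)).comp hs).congr' ?_
      filter_upwards [eventually_gt_atTop s] with t ht
      simp [ht]
    · intro t s
      split_ifs with hst
      · have hp := pow_mem hM (t - 1 - s)
        exact abs_mulVec_le (fun _ _ => nonneg_of_mem_rowStochastic hp)
          (fun _ => (sum_row_of_mem_rowStochastic hp _).le) (he s) i
      · simpa using (abs_nonneg _).trans (he s i)
  refine ((hlim (y 0)).add hsum).congr fun t => ?_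
  rw [eq_pow_mulVec_add_sum h t, Pi.add_apply, Finset.sum_apply,
    tsum_eq_sum (s := Finset.range t) (by simp +contextual)]
  congr 1
  exact Finset.sum_congr rfl fun s hs => by simp [Finset.mem_range.mp hs]

end Stochastic

/-! ### Substochastic matrices and the spectral radius -/

section Substochastic

variable {n : ℕ} {N : Matrix (Fin n) (Fin n) ℝ}

theorem mulVec_mono_right (hN : ∀ v w, 0 ≤ N v w) {x y : Fin n → ℝ} (h : ∀ v, x v ≤ y v)
    (v : Fin n) : (N *ᵥ x) v ≤ (N *ᵥ y) v := by
  simp only [mulVec, dotProduct]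
  exact Finset.sum_le_sum fun w _ => mul_le_mul_of_nonneg_left (h w) (hN v w)

theorem antitone_pow_mulVec_one (hN : ∀ v w, 0 ≤ N v w) (h1 : ∀ v, (N *ᵥ 1) v ≤ 1) (v : Fin n) :
    Antitone fun t => (N ^ t *ᵥ 1) v := by
  refine antitone_nat_of_succ_le fun t => ?_
  rw [pow_succ, ← mulVec_mulVec]
  exact mulVec_mono_right (pow_apply_nonneg hN t) h1 v

theorem summable_pow_mulVec_one (hN : ∀ v w, 0 ≤ N v w) {K : ℕ} {θ : ℝ} (hθ : θ < 1)
    (hK : ∀ v, (N ^ K *ᵥ 1) v ≤ θ) (v : Fin n) : Summable fun t => (N ^ t *ᵥ 1) v := by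
  refine summable_of_shift_le (K := K) (fun t => ?_) hθ fun t => ?_
  · simp only [mulVec, dotProduct]
    exact Finset.sum_nonneg fun w _ => by simpa using pow_apply_nonneg hN t v w
  · rw [pow_add, ← mulVec_mulVec]
    have := mulVec_mono_right (y := θ • 1) (pow_apply_nonneg hN t) (by simpa using hK) v
    rwa [mulVec_smul] at this

theorem summable_pow_mulVec (hN : ∀ v w, 0 ≤ N v w) {K : ℕ} {θ : ℝ} (hθ : θ < 1)
    (hK : ∀ v, (N ^ K *ᵥ 1) v ≤ θ) (u : Fin n → ℝ) (v : Fin n) :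
    Summable fun t => (N ^ t *ᵥ u) v := by
  have happly : ∀ w, Summable fun t => (N ^ t) v w := fun w =>
    Summable.of_nonneg_of_le (fun t => pow_apply_nonneg hN t v w) (fun t => by
      simpa [mulVec, dotProduct] using Finset.single_le_sum (f := fun w => (N ^ t) v w)
        (fun w _ => pow_apply_nonneg hN t v w) (Finset.mem_univ w))
      (summable_pow_mulVec_one hN hθ hK v)
  simp only [mulVec, dotProduct]
  exact summable_sum fun w _ => (happly w).mul_right _

-- the operator norm of the sup norm is the largest absolute row sum
attribute [local instance] Matrix.linftyOpNormedRing Matrix.linftyOpNormedAlgebra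

theorem spectralRad_lt_one [NeZero n] (hN : ∀ v w, 0 ≤ N v w) {K : ℕ} {θ : ℝ} (hθ : θ < 1)
    (hK : ∀ v, (N ^ K *ᵥ 1) v ≤ θ) : spectralRad N < 1 := by
  have h : spectralRadius ℂ (N.map Complex.ofReal) < ((1 : NNReal) : ENNReal) := by
    refine spectrum.spectralRadius_lt_of_forall_lt _ fun μ hμ => ?_
    by_contra! hlt
    have hpow : ‖μ ^ K‖ ≤ ‖N.map Complex.ofReal ^ K‖ :=
      spectrum.norm_le_norm_of_mem (spectrum.pow_mem_pow _ _ hμ)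
    have hmap : N.map Complex.ofReal ^ K = (N ^ K).map Complex.ofReal :=
      (map_pow (Complex.ofRealHom.mapMatrix) N K).symm
    have hone : (1 : ℝ) ≤ ‖μ ^ K‖ := by
      rw [norm_pow]
      exact one_le_pow₀ (by exact_mod_cast hlt)
    have hlt1 : ‖N.map Complex.ofReal ^ K‖₊ < 1 := by
      rw [hmap, linfty_opNNNorm_def, Finset.sup_lt_iff (by simp)]
      intro v _
      rw [← NNReal.coe_lt_coe]
      refine lt_of_le_of_lt (le_of_eq ?_) ((hK v).trans_lt hθ)
      simp only [NNReal.coe_sum, coe_nnnorm, map_apply, Complex.norm_real, mulVec, dotProduct,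
        Pi.one_apply, mul_one]
      exact Finset.sum_congr rfl fun w _ => abs_of_nonneg (pow_apply_nonneg hN K v w)
    exact absurd (hone.trans hpow) (not_le.mpr (by exact_mod_cast hlt1))
  have := (ENNReal.toReal_lt_toReal (ne_top_of_lt h) ENNReal.coe_ne_top).mpr h
  simpa [spectralRad] using this

theorem norm_le_spectralRad [NeZero n] {μ : ℂ} (hμ : μ ∈ spectrum ℂ (N.map Complex.ofReal)) :
    ‖μ‖ ≤ spectralRad N := by
  have hfin : spectralRadius ℂ (N.map Complex.ofReal) ≠ ⊤ :=
    ne_top_of_le_ne_top ENNReal.coe_ne_top (spectrum.spectralRadius_le_nnnorm _)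
  have : (‖μ‖₊ : ENNReal) ≤ spectralRadius ℂ (N.map Complex.ofReal) :=
    le_iSup₂ (f := fun k (_ : k ∈ spectrum ℂ (N.map Complex.ofReal)) => (‖k‖₊ : ENNReal)) μ hμ
  simpa [spectralRad] using ENNReal.toReal_mono hfin this

theorem spectralRad_smul [NeZero n] (c : ℝ) : spectralRad (c • N) = |c| * spectralRad N := by
  have hmap : (c • N).map Complex.ofReal = (c : ℂ) • N.map Complex.ofReal := by
    ext; simp
  rw [spectralRad, spectralRad, hmap, spectralRadius,
    spectrum.smul_eq_smul _ _ (spectrum.nonempty _), spectralRadius, ← Set.image_smul, iSup_image]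
  simp only [smul_eq_mul, nnnorm_mul, ENNReal.coe_mul, ← ENNReal.mul_iSup, ENNReal.toReal_mul]
  simp

/-- Each factor of `det (1 - N) = ∏ (1 - μ)`, over the complex eigenvalues `μ`, has modulus at
least `1 - ρ(N)`. -/
theorem pow_one_sub_spectralRad_le_abs_det [NeZero n] (h : spectralRad N < 1) :
    (1 - spectralRad N) ^ n ≤ |(1 - N).det| := by
  set B := N.map Complex.ofReal with hB
  have hdet : (((1 - N).det : ℝ) : ℂ) = (B.charpoly.roots.map fun μ => 1 - μ).prod := by
    have h1 : (((1 - N).det : ℝ) : ℂ) = B.charpoly.eval 1 := by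
      rw [eval_charpoly]
      have := Complex.ofRealHom.map_det (1 - N)
      rw [map_sub, map_one] at this
      rw [map_one]
      exact this
    have h2 := (IsAlgClosed.splits B.charpoly).eq_prod_roots_of_monic B.charpoly_monic
    rw [h1]
    conv_lhs => rw [h2]
    rw [Polynomial.eval_multiset_prod, Multiset.map_map]
    simp
  have hcard : B.charpoly.roots.card = n := by
    rw [← (IsAlgClosed.splits B.charpoly).natDegree_eq_card_roots, charpoly_natDegree_eq_dim,
      Fintype.card_fin]
  have hnorm : |(1 - N).det| = (B.charpoly.roots.map fun μ => ‖1 - μ‖).prod := by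
    rw [← Real.norm_eq_abs, ← Complex.norm_real, hdet]
    have := map_multiset_prod (normHom : ℂ →*₀ ℝ) (B.charpoly.roots.map fun μ => 1 - μ)
    rwa [Multiset.map_map] at this
  have hle : ∀ s : Multiset ℂ, (∀ μ ∈ s, ‖μ‖ ≤ spectralRad N) →
      (1 - spectralRad N) ^ s.card ≤ (s.map fun μ => ‖1 - μ‖).prod := by
    intro s
    induction s using Multiset.induction with
    | empty => simp
    | cons μ s ih =>
      intro hs
      rw [Multiset.card_cons, pow_succ', Multiset.map_cons, Multiset.prod_cons]
      refine mul_le_mul ?_ (ih fun ν hν => hs ν (Multiset.mem_cons_of_mem hν))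
        (pow_nonneg (by linarith) _) (norm_nonneg _)
      have := norm_sub_norm_le (1 : ℂ) μ
      rw [norm_one] at this
      linarith [hs μ (Multiset.mem_cons_self μ s)]
  rw [hnorm]
  refine (congrArg ((1 - spectralRad N) ^ ·) hcard).ge.trans <|
    hle _ fun μ hμ => norm_le_spectralRad ?_
  rw [mem_spectrum_iff_isRoot_charpoly]
  exact Polynomial.isRoot_of_mem_roots hμ

/-- The solution of `(1 - N) u = b` is bounded through Cramer's rule: the entries of `1 - N` lie in
`[-1, 1]`, so those of its adjugate are at most `n!`. -/
theorem abs_le_of_one_sub_mulVec_eq [NeZero n] (h0 : ∀ v w, 0 ≤ N v w) (h1 : ∀ v w, N v w ≤ 1)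
    (hρ : spectralRad N < 1) {u b : Fin n → ℝ} (h : (1 - N) *ᵥ u = b) (v : Fin n) :
    |u v| ≤ n.factorial * (∑ w, |b w|) / (1 - spectralRad N) ^ n := by
  have hpos : 0 < (1 - spectralRad N) ^ n := pow_pos (by linarith) n
  have hentry : ∀ i j, |(1 - N) i j| ≤ 1 := by
    intro i j
    rw [Matrix.sub_apply, Matrix.one_apply, abs_le]
    have := h0 i j
    have := h1 i j
    split_ifs <;> constructor <;> linarith
  have hadj : ∀ i j, |adjugate (1 - N) i j| ≤ (n.factorial : ℝ) := by
    intro i j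
    rw [adjugate_apply]
    have := Matrix.det_le (A := (1 - N).updateRow j (Pi.single i 1))
      (abv := AbsoluteValue.abs) (x := (1 : ℝ)) (fun k l => by
        rw [AbsoluteValue.abs_apply, Matrix.updateRow_apply]
        split_ifs
        · rw [Pi.single_apply]; split_ifs <;> simp
        · exact hentry k l)
    simpa using this
  have hdet : (1 - N).det * u v = (adjugate (1 - N) *ᵥ b) v := by
    rw [← h, mulVec_mulVec, adjugate_mul, smul_mulVec, one_mulVec, Pi.smul_apply, smul_eq_mul]
  rw [le_div_iff₀ hpos]
  calc |u v| * (1 - spectralRad N) ^ n ≤ |u v| * |(1 - N).det| :=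
        mul_le_mul_of_nonneg_left (pow_one_sub_spectralRad_le_abs_det hρ) (abs_nonneg _)
    _ = |(adjugate (1 - N) *ᵥ b) v| := by rw [← abs_mul, mul_comm, hdet]
    _ ≤ ∑ w, |adjugate (1 - N) v w * b w| := by
        rw [mulVec, dotProduct]
        exact Finset.abs_sum_le_sum_abs _ _
    _ ≤ ∑ w, n.factorial * |b w| := Finset.sum_le_sum fun w _ => by
        rw [abs_mul]
        exact mul_le_mul_of_nonneg_right (hadj v w) (abs_nonneg _)
    _ = n.factorial * ∑ w, |b w| := by rw [Finset.mul_sum]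

theorem hasSum_pow_succ_mulVec {b : Fin n → ℝ} (h : ∀ v, Summable fun t => (N ^ t *ᵥ b) v)
    (v : Fin n) : HasSum (fun t => (N ^ (t + 1) *ᵥ b) v)
      ((N *ᵥ fun v => ∑' t, (N ^ t *ᵥ b) v) v) := by
  have happly : ∀ x : Fin n → ℝ, (N *ᵥ x) v = ∑ w, N v w * x w := fun x => by rw [mulVec, dotProduct]
  simp only [pow_succ', ← mulVec_mulVec, happly]
  exact hasSum_sum fun w _ => (h w).hasSum.mul_left _

/-- The Neumann series `∑ N ^ t b` solves `(1 - N) u = b`. -/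
theorem one_sub_mulVec_tsum {b : Fin n → ℝ} (h : ∀ v, Summable fun t => (N ^ t *ᵥ b) v) :
    (1 - N) *ᵥ (fun v => ∑' t, (N ^ t *ᵥ b) v) = b := by
  ext v
  rw [sub_mulVec, one_mulVec, Pi.sub_apply, ← (hasSum_pow_succ_mulVec h v).tsum_eq,
    (h v).tsum_eq_zero_add]
  simp

end Substochastic

/-! ### The network matrix -/

section Network

variable {n : ℕ} {P : Matrix (Fin n) (Fin n) ℝ} {α β : Fin n → ℝ}

theorem networkMatrix_apply (v w : Fin n) : networkMatrix P α v w = α v * P v w := by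
  simp [networkMatrix]

theorem networkMatrix_smul (c : ℝ) : networkMatrix P (c • α) = c • networkMatrix P α := by
  ext v w
  simp [networkMatrix_apply, mul_assoc]

theorem networkMatrix_mulVec (x : Fin n → ℝ) (v : Fin n) :
    (networkMatrix P α *ᵥ x) v = α v * ∑ w, P v w * x w := by
  simp [mulVec, dotProduct, networkMatrix_apply, Finset.mul_sum, mul_assoc]

theorem networkMatrix_nonneg (hP : P ∈ rowStochastic ℝ (Fin n)) (hα : ∀ v, 0 ≤ α v)
    (v w : Fin n) : 0 ≤ networkMatrix P α v w := by
  rw [networkMatrix_apply]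
  exact mul_nonneg (hα v) (nonneg_of_mem_rowStochastic hP)

theorem networkMatrix_mulVec_one (hP : P ∈ rowStochastic ℝ (Fin n)) (v : Fin n) :
    (networkMatrix P α *ᵥ 1) v = α v := by
  simp [networkMatrix_mulVec, sum_row_of_mem_rowStochastic hP]

/-- A property propagates to all users if it holds where `α v < 1` and passes backwards along the
edges that leave the other nodes. -/
theorem forall_of_walk_induction (hα : ∀ v, α v ≤ 1)
    (hwalk : ∀ v, ∃ w, (∃ k, IsWalkLength P v w k) ∧ α w < 1) {Q : Fin n → Prop}
    (hbase : ∀ v, α v < 1 → Q v) (hstep : ∀ v w, α v = 1 → 0 < P v w → Q w → Q v)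
    (v : Fin n) : Q v := by
  obtain ⟨w, ⟨k, hk⟩, hw⟩ := hwalk v
  induction k generalizing v with
  | zero =>
    obtain ⟨c, rfl, rfl, -⟩ := hk
    exact hbase _ hw
  | succ k ih =>
    obtain ⟨c, rfl, rfl, hc⟩ := hk
    have hQ : Q (c 1) := ih (c 1) ⟨fun j => c (j + 1), rfl, rfl, fun j hj => hc (j + 1) (by omega)⟩
    rcases (hα (c 0)).lt_or_eq with h | h
    · exact hbase _ h
    · exact hstep _ _ h (hc 0 (by omega)) hQ

/-- Some power of the network matrix has all its row sums bounded away from `1`. -/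
theorem exists_pow_networkMatrix_mulVec_one_le [NeZero n] (hP : P ∈ rowStochastic ℝ (Fin n))
    (hα0 : ∀ v, 0 ≤ α v) (hα : ∀ v, α v ≤ 1)
    (hwalk : ∀ v, ∃ w, (∃ k, IsWalkLength P v w k) ∧ α w < 1) :
    ∃ K, ∃ θ < 1, ∀ v, (networkMatrix P α ^ K *ᵥ 1) v ≤ θ := by
  have hN := networkMatrix_nonneg hP hα0
  have hanti := antitone_pow_mulVec_one hN fun v => (networkMatrix_mulVec_one hP v).trans_le (hα v)
  have hex : ∀ v, ∃ t, (networkMatrix P α ^ t *ᵥ 1) v < 1 := by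
    refine forall_of_walk_induction hα hwalk (fun v hv => ⟨1, ?_⟩) ?_
    · rwa [pow_one, networkMatrix_mulVec_one hP]
    · rintro v w hv hvw ⟨t, ht⟩
      refine ⟨t + 1, ?_⟩
      rw [pow_succ', ← mulVec_mulVec, networkMatrix_mulVec, hv, one_mul,
        ← sum_row_of_mem_rowStochastic hP v]
      refine Finset.sum_lt_sum (fun u _ => ?_) ⟨w, Finset.mem_univ w, by nlinarith⟩
      refine mul_le_of_le_one_right (nonneg_of_mem_rowStochastic hP) ?_
      simpa using hanti u (Nat.zero_le t)
  choose t ht using hex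
  obtain ⟨v₀, hv₀⟩ := Finite.exists_max fun v => (networkMatrix P α ^ (∑ u, t u) *ᵥ 1) v
  refine ⟨∑ u, t u, _, ?_, hv₀⟩
  exact (hanti v₀ (Finset.single_le_sum (fun _ _ => Nat.zero_le _) (Finset.mem_univ v₀))).trans_lt
    (ht v₀)

/-- The total effect of the initial excess `b`, spread over the users, is bounded uniformly: Cramer's
rule bounds the Neumann series, and one more multiplication by the network matrix gains the factor
`‖α‖`. -/
theorem tsum_sum_pow_succ_mulVec_le [NeZero n] (hP : P ∈ rowStochastic ℝ (Fin n))
    (hα0 : ∀ v, 0 ≤ α v) (hα : ∀ v, α v ≤ 1) (hρ : spectralRad (networkMatrix P α) < 1)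
    {b : Fin n → ℝ} (h : ∀ v, Summable fun t => (networkMatrix P α ^ t *ᵥ b) v) :
    (Summable fun t => (∑ v, (networkMatrix P α ^ (t + 1) *ᵥ b) v) / n) ∧
    ∑' t, (∑ v, (networkMatrix P α ^ (t + 1) *ᵥ b) v) / n ≤
      ‖α‖ * (n.factorial * (∑ w, |b w|) / (1 - spectralRad (networkMatrix P α)) ^ n) := by
  set N := networkMatrix P α with hNdef
  have hN : ∀ v w, 0 ≤ N v w := networkMatrix_nonneg hP hα0
  have hN1 : ∀ v w, N v w ≤ 1 := fun v w => by
    rw [hNdef, networkMatrix_apply]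
    exact mul_le_one₀ (hα v) (nonneg_of_mem_rowStochastic hP) (le_one_of_mem_rowStochastic hP)
  set u : Fin n → ℝ := fun v => ∑' t, (N ^ t *ᵥ b) v
  set D := n.factorial * (∑ w, |b w|) / (1 - spectralRad N) ^ n with hD
  have hu : ∀ v, |u v| ≤ D := abs_le_of_one_sub_mulVec_eq hN hN1 hρ (one_sub_mulVec_tsum h)
  have hD0 : 0 ≤ D := (abs_nonneg _).trans (hu 0)
  have hsum : HasSum (fun t => (∑ v, (N ^ (t + 1) *ᵥ b) v) / n) ((∑ v, (N *ᵥ u) v) / n) :=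
    (hasSum_sum fun v _ => hasSum_pow_succ_mulVec h v).div_const _
  refine ⟨hsum.summable, ?_⟩
  rw [hsum.tsum_eq, div_le_iff₀ (by exact_mod_cast NeZero.pos n)]
  calc ∑ v, (N *ᵥ u) v ≤ ∑ _v : Fin n, ‖α‖ * D := Finset.sum_le_sum fun v _ => by
        calc (N *ᵥ u) v ≤ (N *ᵥ (D • 1)) v :=
              mulVec_mono_right hN (fun w => by simpa using (le_abs_self _).trans (hu w)) v
          _ = α v * D := by
              rw [mulVec_smul, Pi.smul_apply, networkMatrix_mulVec_one hP, smul_eq_mul, mul_comm]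
          _ ≤ ‖α‖ * D := mul_le_mul_of_nonneg_right
              ((le_abs_self _).trans (norm_le_pi_norm α v)) hD0
    _ = ‖α‖ * D * n := by simp [mul_comm]

/-! ### The joint matrix -/

theorem jointMatrix_mulVec_inl (ζ : Fin n → ℝ) (y : Fin n ⊕ Unit → ℝ) (v : Fin n) :
    (jointMatrix P α β ζ *ᵥ y) (Sum.inl v) =
      (networkMatrix P α *ᵥ (y ∘ Sum.inl)) v + β v * y (Sum.inr ()) := by
  simp [jointMatrix, mulVec, dotProduct]

/-- The last entry is the normalized sum of the others, as it should be for the popularity. -/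
theorem jointMatrix_mulVec_inr (ζ : Fin n → ℝ) (y : Fin n ⊕ Unit → ℝ) :
    (jointMatrix P α β ζ *ᵥ y) (Sum.inr ()) =
      (∑ v, (jointMatrix P α β ζ *ᵥ y) (Sum.inl v)) / ∑ v, ζ v := by
  simp only [jointMatrix_mulVec_inl, Finset.sum_add_distrib, ← Finset.sum_mul]
  simp only [jointMatrix, mulVec, dotProduct, Fintype.sum_sum_type, fromBlocks_apply₂₁,
    fromBlocks_apply₂₂, of_apply, Finset.univ_unique, Finset.sum_singleton, Function.comp_apply]
  rw [Finset.sum_comm]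
  simp only [← Finset.sum_mul]
  rw [add_div]
  congr 1
  · rw [Finset.sum_div]
    exact Finset.sum_congr rfl fun w _ => by rw [div_mul_eq_mul_div]
  · exact div_mul_eq_mul_div _ _ _

theorem jointMatrix_nonneg (hP : P ∈ rowStochastic ℝ (Fin n)) (hα : ∀ v, 0 ≤ α v)
    (hβ : ∀ v, 0 ≤ β v) {ζ : Fin n → ℝ} (hζ : ∀ v, 0 ≤ ζ v) (i j : Fin n ⊕ Unit) :
    0 ≤ jointMatrix P α β ζ i j := by
  have hN := networkMatrix_nonneg hP hα
  rcases i with v | _ <;> rcases j with w | _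
  · exact hN v w
  · exact hβ v
  · exact div_nonneg (Finset.sum_nonneg fun v _ => hN v w) (Finset.sum_nonneg fun v _ => hζ v)
  · exact div_nonneg (Finset.sum_nonneg fun v _ => hβ v) (Finset.sum_nonneg fun v _ => hζ v)

theorem sum_jointMatrix_inl (hP : P ∈ rowStochastic ℝ (Fin n)) (hαβ : ∀ v, α v + β v = 1)
    (ζ : Fin n → ℝ) (v : Fin n) : ∑ j, jointMatrix P α β ζ (Sum.inl v) j = 1 := by
  have h := jointMatrix_mulVec_inl (P := P) (α := α) (β := β) ζ 1 v
  have h1 : ((1 : Fin n ⊕ Unit → ℝ) ∘ Sum.inl) = 1 := rfl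
  rw [h1, networkMatrix_mulVec_one hP, Pi.one_apply, mul_one, hαβ] at h
  rw [← h]
  simp only [mulVec, dotProduct, Pi.one_apply, mul_one]

theorem sum_jointMatrix_inr (hP : P ∈ rowStochastic ℝ (Fin n)) (hαβ : ∀ v, α v + β v = 1)
    (ζ : Fin n → ℝ) : ∑ j, jointMatrix P α β ζ (Sum.inr ()) j = n / ∑ v, ζ v := by
  have h := jointMatrix_mulVec_inr (P := P) (α := α) (β := β) ζ 1
  have h2 : ∀ v, (jointMatrix P α β ζ *ᵥ 1) (Sum.inl v) = 1 := fun v => by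
    rw [← sum_jointMatrix_inl hP hαβ ζ v]
    simp only [mulVec, dotProduct, Pi.one_apply, mul_one]
  simp only [h2, Finset.sum_const, Finset.card_univ, Fintype.card_fin, nsmul_eq_mul, mul_one] at h
  rw [← h]
  simp only [mulVec, dotProduct, Pi.one_apply, mul_one]

theorem sum_jointMatrix_le_one [NeZero n] (hP : P ∈ rowStochastic ℝ (Fin n))
    (hαβ : ∀ v, α v + β v = 1) {ζ : Fin n → ℝ} (hζ : ∀ v, 1 ≤ ζ v) (i : Fin n ⊕ Unit) :
    ∑ j, jointMatrix P α β ζ i j ≤ 1 := by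
  rcases i with v | _
  · exact (sum_jointMatrix_inl hP hαβ ζ v).le
  · rw [sum_jointMatrix_inr hP hαβ]
    have h : (n : ℝ) ≤ ∑ v, ζ v := by
      simpa using Finset.sum_le_sum fun v (_ : v ∈ Finset.univ) => hζ v
    exact div_le_one_of_le₀ h ((Nat.cast_nonneg n).trans h)

theorem jointMatrix_one_mem_rowStochastic [NeZero n] (hP : P ∈ rowStochastic ℝ (Fin n))
    (hα : ∀ v, 0 ≤ α v) (hβ : ∀ v, 0 ≤ β v) (hαβ : ∀ v, α v + β v = 1) :
    jointMatrix P α β 1 ∈ rowStochastic ℝ (Fin n ⊕ Unit) := by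
  rw [mem_rowStochastic_iff_sum]
  refine ⟨jointMatrix_nonneg hP hα hβ fun _ => zero_le_one, ?_⟩
  rintro (v | _)
  · exact sum_jointMatrix_inl hP hαβ 1 v
  · rw [sum_jointMatrix_inr hP hαβ]
    simp [NeZero.ne]

/-- The popularity node carries a loop and can be reached from every node, so that some power of the
limiting joint matrix has a positive last column. -/
theorem exists_le_pow_jointMatrix_one_inr [NeZero n] (hP : P ∈ rowStochastic ℝ (Fin n))
    (hα : ∀ v, 0 ≤ α v) (hβ : ∀ v, 0 ≤ β v) (hαβ : ∀ v, α v + β v = 1)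
    (hwalk : ∀ v, ∃ w, (∃ k, IsWalkLength P v w k) ∧ α w < 1) :
    ∃ K, ∃ δ > 0, ∀ i, δ ≤ (jointMatrix P α β 1 ^ K) i (Sum.inr ()) := by
  set M := jointMatrix P α β 1 with hM
  have hM0 : ∀ i j, 0 ≤ M i j := jointMatrix_nonneg hP hα hβ fun _ => zero_le_one
  have hMt : ∀ t i j, 0 ≤ (M ^ t) i j := fun t => Matrix.pow_apply_nonneg hM0 t
  have hmul : ∀ {s t i j k}, 0 < (M ^ s) i j → 0 < (M ^ t) j k → 0 < (M ^ (s + t)) i k := by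
    intro s t i j k h1 h2
    rw [pow_add, Matrix.mul_apply]
    exact Finset.sum_pos' (fun l _ => mul_nonneg (hMt s i l) (hMt t l k))
      ⟨j, Finset.mem_univ j, mul_pos h1 h2⟩
  have hα1 : ∀ v, α v ≤ 1 := fun v => by linarith [hαβ v, hβ v]
  have hβpos : ∀ v, α v < 1 → 0 < β v := fun v hv => by linarith [hαβ v]
  have hloop : 0 < M (Sum.inr ()) (Sum.inr ()) := by
    obtain ⟨w, -, hw⟩ := hwalk 0
    refine div_pos (Finset.sum_pos' (fun v _ => hβ v) ⟨w, Finset.mem_univ w, hβpos w hw⟩) ?_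
    simpa using NeZero.pos n
  have hloops : ∀ t, 0 < (M ^ t) (Sum.inr ()) (Sum.inr ()) := by
    intro t
    induction t with
    | zero => simp
    | succ t ih => exact hmul ih (by rwa [pow_one])
  have hex : ∀ v, ∃ t, 0 < (M ^ t) (Sum.inl v) (Sum.inr ()) := by
    refine forall_of_walk_induction hα1 hwalk (fun v hv => ⟨1, ?_⟩) ?_
    · rw [pow_one]
      exact hβpos v hv
    · rintro v w hv hvw ⟨t, ht⟩
      refine ⟨1 + t, hmul (j := Sum.inl w) ?_ ht⟩
      rw [pow_one, hM, jointMatrix, fromBlocks_apply₁₁, networkMatrix_apply, hv, one_mul]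
      exact hvw
  choose t ht using hex
  have hpos : ∀ i, 0 < (M ^ ∑ u, t u) i (Sum.inr ()) := by
    rintro (v | _)
    · have hle : t v ≤ ∑ u, t u :=
        Finset.single_le_sum (fun _ _ => Nat.zero_le _) (Finset.mem_univ v)
      rw [← Nat.add_sub_cancel' hle]
      exact hmul (ht v) (hloops _)
    · exact hloops _
  obtain ⟨i₀, hi₀⟩ := Finite.exists_min fun i => (M ^ ∑ u, t u) i (Sum.inr ())
  exact ⟨∑ u, t u, _, hpos i₀, hi₀⟩

/-- The solutions of the joint dynamics reach consensus, at a value that differs from the stationary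
mean of the initial value by at most the total effect of the initial excess `b = z(0) - 1`. -/
theorem exists_tendsto_of_joint_dynamics [NeZero n] (hP : P ∈ rowStochastic ℝ (Fin n))
    (hα : ∀ v, 0 ≤ α v) (hβ : ∀ v, 0 ≤ β v) (hαβ : ∀ v, α v + β v = 1) {ψ : Fin n ⊕ Unit → ℝ}
    (hψ : ∀ i j, Tendsto (fun t => (jointMatrix P α β 1 ^ t) i j) atTop (𝓝 (ψ j)))
    {b : Fin n → ℝ} (hb : ∀ v, 0 ≤ b v)
    (hsum : Summable fun t => (∑ v, (networkMatrix P α ^ (t + 1) *ᵥ b) v) / n)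
    {y : ℕ → Fin n ⊕ Unit → ℝ}
    (hy : ∀ t, y (t + 1) = jointMatrix P α β (1 + networkMatrix P α ^ (t + 1) *ᵥ b) *ᵥ y t) :
    ∃ c, Tendsto y atTop (𝓝 fun _ => c) ∧ ∀ C, (∀ i, |y 0 i| ≤ C) →
      |c - ψ ⬝ᵥ y 0| ≤ C * ∑' t, (∑ v, (networkMatrix P α ^ (t + 1) *ᵥ b) v) / n := by
  set N := networkMatrix P α with hNdef
  have hn : (0 : ℝ) < n := by exact_mod_cast NeZero.pos n
  have hNb : ∀ t v, 0 ≤ (N ^ t *ᵥ b) v := fun t v => by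
    simpa using mulVec_mono_right (x := 0)
      (Matrix.pow_apply_nonneg (networkMatrix_nonneg hP hα) t) hb v
  set ε : ℕ → ℝ := fun t => (∑ v, (N ^ (t + 1) *ᵥ b) v) / n with hε
  have hε0 : ∀ t, 0 ≤ ε t := fun t => div_nonneg (Finset.sum_nonneg fun v _ => hNb _ v) hn.le
  have hM := jointMatrix_one_mem_rowStochastic hP hα hβ hαβ
  have hst := isStationaryDistribution_of_tendsto hM hψ
  have hψ1 : ψ (Sum.inr ()) ≤ 1 := by
    rw [← hst.1.2]
    exact Finset.single_le_sum (fun i _ => hst.1.1 i) (Finset.mem_univ _)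
  have hbound : ∀ C, (∀ i, |y 0 i| ≤ C) → ∀ t i, |y t i| ≤ C := by
    intro C hC t
    induction t with
    | zero => exact hC
    | succ t ih =>
      rw [hy]
      have h1 : ∀ v, 1 ≤ (1 + N ^ (t + 1) *ᵥ b) v := fun v => by simpa using hNb (t + 1) v
      exact abs_mulVec_le (jointMatrix_nonneg hP hα hβ fun v => zero_le_one.trans (h1 v))
        (sum_jointMatrix_le_one hP hαβ h1) ih
  -- the joint matrices differ from their limit in the last row only, by a scalar factor
  set e : ℕ → Fin n ⊕ Unit → ℝ := fun t => Pi.single (Sum.inr ()) (-(ε t * y (t + 1) (Sum.inr ())))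
    with he
  have hye : ∀ t, y (t + 1) = jointMatrix P α β 1 *ᵥ y t + e t := by
    intro t
    have hinl : ∀ v, y (t + 1) (Sum.inl v) = (jointMatrix P α β 1 *ᵥ y t) (Sum.inl v) := fun v => by
      rw [hy, jointMatrix_mulVec_inl, jointMatrix_mulVec_inl]
    ext (v | _)
    · simp [he, hinl]
    · have h1 : y (t + 1) (Sum.inr ()) =
          (∑ v, y (t + 1) (Sum.inl v)) / ∑ v, (1 + N ^ (t + 1) *ᵥ b) v := by
        rw [hy, jointMatrix_mulVec_inr]
      have hZ : ∑ v, (1 + N ^ (t + 1) *ᵥ b) v = n * (1 + ε t) := by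
        simp only [Pi.add_apply, Pi.one_apply, Finset.sum_add_distrib, hε]
        field_simp
        simp
      rw [hZ, eq_div_iff (mul_pos hn (by linarith [hε0 t])).ne'] at h1
      rw [Pi.add_apply, jointMatrix_mulVec_inr, he]
      simp only [Pi.single_eq_same, ← hinl, ← h1, Pi.one_apply, Finset.sum_const,
        Finset.card_univ, Fintype.card_fin, nsmul_eq_mul, mul_one]
      field_simp
      ring
  have hebound : ∀ C, (∀ i, |y 0 i| ≤ C) → ∀ t i, |e t i| ≤ C * ε t := by
    intro C hC t i
    have hC0 : 0 ≤ C := (abs_nonneg _).trans (hC i)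
    rw [he]
    simp only [Pi.single_apply]
    split_ifs
    · rw [abs_neg, abs_mul, abs_of_nonneg (hε0 t), mul_comm]
      exact mul_le_mul_of_nonneg_right (hbound C hC _ _) (hε0 t)
    · simpa using mul_nonneg hC0 (hε0 t)
  have h0 : ∀ i, |y 0 i| ≤ ‖y 0‖ := fun i => norm_le_pi_norm (y 0) i
  refine ⟨ψ ⬝ᵥ y 0 + ∑' s, ψ ⬝ᵥ e s, tendsto_pi_nhds.mpr fun i =>
    tendsto_of_perturbed hM hψ hye (hsum.mul_left _) (hebound _ h0) i, fun C hC => ?_⟩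
  rw [add_sub_cancel_left, ← tsum_mul_left, ← Real.norm_eq_abs]
  refine tsum_of_norm_bounded (hsum.mul_left C).hasSum fun t => ?_
  rw [he, dotProduct_single, Real.norm_eq_abs, abs_mul, abs_of_nonneg (hst.1.1 _)]
  have := hebound C hC t (Sum.inr ())
  simp only [he, Pi.single_eq_same] at this
  exact (mul_le_of_le_one_left (abs_nonneg _) hψ1).trans this

end Network

/-! ### The attention dynamics without quality -/

section Attention

variable {n : ℕ} {ι : Type*} [Fintype ι] {P : Matrix (Fin n) (Fin n) ℝ} {α β γ : Fin n → ℝ}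
  {q : ι → ℝ} {x₀ : ι → Fin n → ℝ}

theorem attention_succ (hγ : ∀ v, γ v = 0) (t : ℕ) (i : ι) (v : Fin n) :
    attention P α β γ q x₀ (t + 1) i v =
      (networkMatrix P α *ᵥ attention P α β γ q x₀ t i) v +
        β v * popularity (attention P α β γ q x₀ t) i := by
  simp only [attention, networkMatrix_mulVec, hγ, zero_mul, add_zero]

theorem jointState_attention_succ (hγ : ∀ v, γ v = 0) (t : ℕ) (i : ι) :
    jointState (attention P α β γ q x₀ (t + 1)) i =
      jointMatrix P α β (totalAttention (attention P α β γ q x₀ (t + 1))) *ᵥ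
        jointState (attention P α β γ q x₀ t) i := by
  have hinl : ∀ ζ v, (jointMatrix P α β ζ *ᵥ jointState (attention P α β γ q x₀ t) i) (Sum.inl v) =
      attention P α β γ q x₀ (t + 1) i v := fun ζ v => by
    rw [jointMatrix_mulVec_inl, attention_succ hγ]
    rfl
  ext (v | _)
  · rw [hinl]
    rfl
  · rw [jointMatrix_mulVec_inr]
    simp only [hinl]
    change popularity _ i = _
    rw [popularity, Finset.sum_comm (f := fun j w => attention P α β γ q x₀ (t + 1) j w)]
    rfl

theorem sum_popularity {x : ι → Fin n → ℝ} (h : ∑ j, ∑ w, x j w ≠ 0) :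
    ∑ i, popularity x i = 1 := by
  simp only [popularity]
  rw [← Finset.sum_div, div_self h]

/-- Without quality the total attention evolves on its own: its excess over `1` is multiplied by the
network matrix in each step. -/
theorem totalAttention_attention [NeZero n] (hP : P ∈ rowStochastic ℝ (Fin n))
    (hα : ∀ v, 0 ≤ α v) (hαβ : ∀ v, α v + β v = 1) (hγ : ∀ v, γ v = 0)
    (h0 : ∀ v, 1 ≤ totalAttention x₀ v) (t : ℕ) :
    totalAttention (attention P α β γ q x₀ t) =
      1 + networkMatrix P α ^ t *ᵥ (totalAttention x₀ - 1) := by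
  induction t with
  | zero => simp [attention]
  | succ t ih =>
    have hnn : ∀ v, 0 ≤ (networkMatrix P α ^ t *ᵥ (totalAttention x₀ - 1)) v := fun v => by
      simpa using mulVec_mono_right (x := 0) (y := totalAttention x₀ - 1)
        (Matrix.pow_apply_nonneg (networkMatrix_nonneg hP hα) t) (by simpa using h0) v
    have hne : ∑ j, ∑ w, attention P α β γ q x₀ t j w ≠ 0 := by
      rw [Finset.sum_comm]
      change ∑ v, totalAttention (attention P α β γ q x₀ t) v ≠ 0
      rw [ih]
      exact (Finset.sum_pos (fun v _ => add_pos_of_pos_of_nonneg one_pos (hnn v))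
        Finset.univ_nonempty).ne'
    ext v
    have hsum : (∑ i, networkMatrix P α *ᵥ attention P α β γ q x₀ t i) =
        networkMatrix P α *ᵥ totalAttention (attention P α β γ q x₀ t) := by
      rw [← mulVec_sum]
      congr 1
      ext w
      simp [totalAttention]
    have hstep : totalAttention (attention P α β γ q x₀ (t + 1)) v =
        (networkMatrix P α *ᵥ totalAttention (attention P α β γ q x₀ t)) v + β v := by
      rw [← hsum, Finset.sum_apply, totalAttention]
      simp only [attention_succ hγ]
      rw [Finset.sum_add_distrib, ← Finset.mul_sum, sum_popularity hne, mul_one]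
    rw [hstep, ih, mulVec_add, mulVec_mulVec, ← pow_succ', Pi.add_apply, Pi.add_apply,
      networkMatrix_mulVec_one hP, Pi.one_apply, ← hαβ v]
    ring

end Attention

/-! ### The constant of the error bound and the convergence theorem -/

/-- The constant in front of the error bound. The ratio `‖α‖ / ρ(A P)`, in the sup norm, is
invariant under scaling of `α`; it turns the factor `‖α‖` of `tsum_sum_pow_succ_mulVec_le` into the
factor `ρ(A P)`. The summand `1` only keeps the constant positive where `ρ(A P) = 0`. -/
noncomputable def scaleFreeConstant {n : ℕ} (P : Matrix (Fin n) (Fin n) ℝ) (α : Fin n → ℝ) : ℝ :=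
  1 + n.factorial * (‖α‖ / spectralRad (networkMatrix P α))

theorem spectralRad_nonneg {n : ℕ} (N : Matrix (Fin n) (Fin n) ℝ) : 0 ≤ spectralRad N :=
  ENNReal.toReal_nonneg

theorem scaleFreeConstant_pos {n : ℕ} (P : Matrix (Fin n) (Fin n) ℝ) (α : Fin n → ℝ) :
    0 < scaleFreeConstant P α := by
  have := spectralRad_nonneg (networkMatrix P α)
  unfold scaleFreeConstant
  positivity

theorem scaleFreeConstant_smul {n : ℕ} [NeZero n] (P : Matrix (Fin n) (Fin n) ℝ) (α : Fin n → ℝ)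
    {c : ℝ} (hc : 0 < c) : scaleFreeConstant P (c • α) = scaleFreeConstant P α := by
  rw [scaleFreeConstant, scaleFreeConstant, networkMatrix_smul, spectralRad_smul, norm_smul,
    Real.norm_eq_abs, mul_div_mul_left _ _ (abs_pos.mpr hc.ne').ne']

theorem norm_mul_factorial_le {n : ℕ} (P : Matrix (Fin n) (Fin n) ℝ) {α : Fin n → ℝ}
    (h1 : spectralRad (networkMatrix P α) < 1)
    (h : 0 < spectralRad (networkMatrix P α) ∨ α = 0) {s : ℝ} (hs : 0 ≤ s) :
    ‖α‖ * (n.factorial * s / (1 - spectralRad (networkMatrix P α)) ^ n) ≤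
      scaleFreeConstant P α * s * (spectralRad (networkMatrix P α) *
        ((Polynomial.X + Polynomial.C 1 : Polynomial ℝ) ^ n).eval
          (spectralRad (networkMatrix P α)) /
        (1 - spectralRad (networkMatrix P α)) ^ (n + 1)) := by
  have hχ := scaleFreeConstant_pos P α
  have hρ0 := spectralRad_nonneg (networkMatrix P α)
  have hscale : ‖α‖ * n.factorial ≤
      scaleFreeConstant P α * spectralRad (networkMatrix P α) := by
    rcases h with h | h
    · rw [scaleFreeConstant, add_mul, mul_assoc, div_mul_cancel₀ _ h.ne']
      linarith
    · rw [h, norm_zero, zero_mul]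
      exact mul_nonneg (scaleFreeConstant_pos P 0).le (spectralRad_nonneg _)
  set ρ := spectralRad (networkMatrix P α)
  simp only [Polynomial.eval_pow, Polynomial.eval_add, Polynomial.eval_X, Polynomial.eval_C]
  have hpow : (1 - ρ) ^ (n + 1) ≤ (1 - ρ) ^ n :=
    pow_le_pow_of_le_one (by linarith) (by linarith) (Nat.le_succ n)
  calc ‖α‖ * (n.factorial * s / (1 - ρ) ^ n) = ‖α‖ * n.factorial * s * 1 / (1 - ρ) ^ n := by ring
    _ ≤ scaleFreeConstant P α * ρ * s * (ρ + 1) ^ n / (1 - ρ) ^ (n + 1) := by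
        have hp : 1 ≤ (ρ + 1) ^ n := one_le_pow₀ (by linarith)
        have hpos : 0 < 1 - ρ := by linarith
        gcongr
    _ = _ := by ring

theorem exists_abs_le_one_dotProduct_eq {m : Type*} [Fintype m] (u : m → ℝ) :
    ∃ σ : m → ℝ, (∀ k, |σ k| ≤ 1) ∧ u ⬝ᵥ σ = ∑ k, |u k| :=
  ⟨fun k => SignType.sign (u k), fun k => by
    rcases lt_trichotomy (u k) 0 with h | h | h <;> simp [h],
    Finset.sum_congr rfl fun k _ => self_mul_sign (u k)⟩

theorem theorem2 (n : ℕ) (hn : 1 ≤ n) :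
    ∃ (p : Polynomial ℝ) (χ : Matrix (Fin n) (Fin n) ℝ → (Fin n → ℝ) → ℝ),
      p.natDegree = n ∧ p.eval 0 = 1 ∧
      (∀ P α, 0 < χ P α) ∧
      (∀ P α, ∀ c : ℝ, 0 < c → χ P (c • α) = χ P α) ∧
      ∀ (P : Matrix (Fin n) (Fin n) ℝ) (α β γ : Fin n → ℝ),
        P ∈ Matrix.rowStochastic ℝ (Fin n) →
        (∀ v, 0 ≤ α v ∧ 0 ≤ β v ∧ 0 ≤ γ v) →
        (∀ v, α v + β v + γ v = 1) →
        (∀ v, γ v = 0) →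
        (∀ v, ∃ w, (∃ k, IsWalkLength P v w k) ∧ IsAperiodicNode P w ∧ α w < 1) →
        spectralRad (networkMatrix P α) < 1 ∧
        (∃! ψ, IsStationaryDistribution (jointMatrix P α β 1) ψ) ∧
        ∀ z₀ : Fin n → ℝ, (∀ v, 1 ≤ z₀ v) →
          ∃ φ : Fin n ⊕ Unit → ℝ,
            (∀ (ι : Type*) [Fintype ι] (q : ι → ℝ) (x₀ : ι → Fin n → ℝ),
              (∀ i v, 0 ≤ x₀ i v ∧ x₀ i v ≤ 1) →
              totalAttention x₀ = z₀ →
              -- the vectors `s i t` follow the joint dynamics `s i (t + 1) = U t *ᵥ s i t`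
              (∀ i t, jointState (attention P α β γ q x₀ (t + 1)) i =
                jointMatrix P α β (totalAttention (attention P α β γ q x₀ (t + 1))) *ᵥ
                  jointState (attention P α β γ q x₀ t) i) ∧
              -- each of them converges to a consensus
              (∀ i, Tendsto (fun t => jointState (attention P α β γ q x₀ t) i) atTop
                (𝓝 fun _ => φ ⬝ᵥ jointState x₀ i)) ∧
              -- and so does every other solution of the joint dynamics, with the same `φ`
              (∀ y : ℕ → Fin n ⊕ Unit → ℝ,
                (∀ t, y (t + 1) =
                  jointMatrix P α β (totalAttention (attention P α β γ q x₀ (t + 1))) *ᵥ y t) →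
                Tendsto y atTop (𝓝 fun _ => φ ⬝ᵥ y 0))) ∧
            (0 < spectralRad (networkMatrix P α) ∨ α = 0 →
              ∀ ψ, IsStationaryDistribution (jointMatrix P α β 1) ψ →
                ∑ k, |φ k - ψ k| ≤
                  χ P α * (∑ v, |z₀ v - 1|) *
                    (spectralRad (networkMatrix P α) * p.eval (spectralRad (networkMatrix P α)) /
                      (1 - spectralRad (networkMatrix P α)) ^ (n + 1))) := by
  have : NeZero n := ⟨by omega⟩
  refine ⟨(Polynomial.X + Polynomial.C 1) ^ n, scaleFreeConstant, ?_, by simp,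
    scaleFreeConstant_pos, fun P α c hc => scaleFreeConstant_smul P α hc, ?_⟩
  · rw [Polynomial.natDegree_pow, Polynomial.natDegree_X_add_C, mul_one]
  intro P α β γ hP hnonneg hone hγ hreach
  have hα : ∀ v, 0 ≤ α v := fun v => (hnonneg v).1
  have hβ : ∀ v, 0 ≤ β v := fun v => (hnonneg v).2.1
  have hαβ : ∀ v, α v + β v = 1 := fun v => by simpa [hγ v] using hone v
  have hα1 : ∀ v, α v ≤ 1 := fun v => by linarith [hαβ v, hβ v]
  have hwalk : ∀ v, ∃ w, (∃ k, IsWalkLength P v w k) ∧ α w < 1 := fun v =>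
    (hreach v).imp fun w hw => ⟨hw.1, hw.2.2⟩
  have hN := networkMatrix_nonneg hP hα
  obtain ⟨K, θ, hθ, hK⟩ := exists_pow_networkMatrix_mulVec_one_le hP hα hα1 hwalk
  obtain ⟨L, δ, hδ0, hδ⟩ := exists_le_pow_jointMatrix_one_inr hP hα hβ hαβ hwalk
  have hM := jointMatrix_one_mem_rowStochastic hP hα hβ hαβ
  obtain ⟨ψ, hψ⟩ := exists_tendsto_pow_apply hM hδ0 hδ
  have hρ := spectralRad_lt_one hN hθ hK
  refine ⟨hρ, ⟨ψ, isStationaryDistribution_of_tendsto hM hψ, fun ψ' h => h.eq_of_tendsto hψ⟩, ?_⟩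
  intro z₀ hz₀
  set b : Fin n → ℝ := z₀ - 1 with hb
  have hb0 : ∀ v, 0 ≤ b v := fun v => by simpa [hb] using hz₀ v
  obtain ⟨hsum, hle⟩ := tsum_sum_pow_succ_mulVec_le hP hα hα1 hρ
    (summable_pow_mulVec hN hθ hK b)
  set E := ∑' t, (∑ v, (networkMatrix P α ^ (t + 1) *ᵥ b) v) / n
  -- `W t` is the product of the first `t` joint matrices; its columns are solutions as well
  let W : ℕ → Matrix (Fin n ⊕ Unit) (Fin n ⊕ Unit) ℝ := fun t =>
    t.rec 1 fun s V => jointMatrix P α β (1 + networkMatrix P α ^ (s + 1) *ᵥ b) * V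
  have hW : ∀ u t, W (t + 1) *ᵥ u =
      jointMatrix P α β (1 + networkMatrix P α ^ (t + 1) *ᵥ b) *ᵥ (W t *ᵥ u) := fun u t =>
    (mulVec_mulVec _ _ _).symm
  have hW0 : ∀ u, W 0 *ᵥ u = u := one_mulVec
  choose φ hφ using fun u =>
    exists_tendsto_of_joint_dynamics hP hα hβ hαβ hψ hb0 hsum (y := fun t => W t *ᵥ u) (hW u)
  have hlin : ∀ u, φ u = (fun k => φ (Pi.single k 1)) ⬝ᵥ u := by
    intro u
    have h1 := tendsto_pi_nhds.mp (hφ u).1 (Sum.inr ())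
    have h2 : Tendsto (fun t => ∑ k, (W t *ᵥ Pi.single k 1) (Sum.inr ()) * u k) atTop
        (𝓝 (∑ k, φ (Pi.single k 1) * u k)) :=
      tendsto_finsetSum _ fun k _ =>
        (tendsto_pi_nhds.mp (hφ (Pi.single k 1)).1 (Sum.inr ())).mul_const _
    refine tendsto_nhds_unique h1 (h2.congr fun t => ?_)
    simp only [mulVec_single_one, col_apply]
    rw [mulVec, dotProduct]
  refine ⟨fun k => φ (Pi.single k 1), ?_, ?_⟩
  · intro ι _ q x₀ _ hx₀
    have htot : ∀ t, totalAttention (attention P α β γ q x₀ t) =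
        1 + networkMatrix P α ^ t *ᵥ b := fun t => by
      rw [totalAttention_attention hP hα hαβ hγ (by simpa [hx₀] using hz₀), hx₀]
    have hsol : ∀ y : ℕ → Fin n ⊕ Unit → ℝ,
        (∀ t, y (t + 1) =
          jointMatrix P α β (totalAttention (attention P α β γ q x₀ (t + 1))) *ᵥ y t) →
        Tendsto y atTop (𝓝 fun _ => (fun k => φ (Pi.single k 1)) ⬝ᵥ y 0) := by
      intro y hy
      have hyW : ∀ t, W t *ᵥ y 0 = y t := by
        intro t
        induction t with
        | zero => exact hW0 _
        | succ t ih => rw [hW, ih, hy, htot]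
      rw [← hlin]
      exact (hφ (y 0)).1.congr hyW
    have hjoint := jointState_attention_succ (P := P) (α := α) (β := β) (q := q) (x₀ := x₀) hγ
    exact ⟨fun i t => hjoint t i, fun i => hsol _ fun t => hjoint t i, hsol⟩
  · intro hpos ψ' hψ'
    rw [hψ'.eq_of_tendsto hψ]
    -- testing against the signs of `φ - ψ` gives the `ℓ¹` norm
    obtain ⟨σ, hσ, hsign⟩ := exists_abs_le_one_dotProduct_eq fun k => φ (Pi.single k 1) - ψ k
    have hdiff := (hφ σ).2 1 (by simpa [hW0] using hσ)
    rw [one_mul, hW0, hlin, ← sub_dotProduct] at hdiff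
    calc ∑ k, |φ (Pi.single k 1) - ψ k| ≤ E := by
          rw [← hsign]
          exact (le_abs_self _).trans hdiff
      _ ≤ _ := hle.trans
          (norm_mul_factorial_le P hρ hpos (Finset.sum_nonneg fun v _ => abs_nonneg _))
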